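/- **Notation for perturbed linear programs.** Given $A^{(0)},A^{(1)}\in\mathbb R^{m\times n}$, $b^{(0)},b^{(1)}\in\mathbb R^m$, $c^{(0)},c^{(1)}\in\mathbb R^n$, let $\theta(\varepsilon)=\{x\ge 0: (A^{(0)}+\varepsilon A^{(1)})x=b^{(0)}+\varepsilon b^{(1)}\}$, let $F^*(\varepsilon)$ be the value of $\max\{\langle c^{(0)}+\varepsilon c^{(1)},x\rangle : x\in\theta(\varepsilon)\}$ and $\theta^*(\varepsilon)$ its set of optimal solutions. Let $J_0=\{j:\exists x\in\theta(0),\ x_j>0\}$, let $\Theta_1$ be the set of pairs $(x^0,x^1)$ with $x^0\in\theta(0)$, $A^{(0)}x^1+A^{(1)}x^0=b^{(1)}$ and $x^1_j\ge 0$ for $j\notin J_0$, and let $\theta_1=\{x^0:(x^0,x^1)\in\Theta_1 \text{ for some } x^1\}$. Consider the conditions: - $(H_0^*)$: there are $\gamma_0>0$ and a bounded set $B$ with $\theta^*(\varepsilon)\subset B$ for all $\varepsilon\in(0,\gamma_0]$; - $(H_1)$: $\operatorname{rank}A^{(0)}=m$; - ES-1: there is $(\hat x^0,\hat x^1)\in\Theta_1$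 with $\hat x^1_j>0$ for all $j\notin J_0$ and $\hat x^0_j>0$ for all $j\in J_0$. A vector $x$ is *feasible limiting optimal* if $x\in\liminf_{\varepsilon\downarrow0}\theta(\varepsilon)$ and $\lim_{\varepsilon\downarrow0}F^*(\varepsilon)=\langle c^{(0)},x\rangle$. Limits of sets are in the sense of Painlevé–Kuratowski. **Theorem.** Consider a Markov decision process with finite state space $X$, finite action sets $A(i)$, real rewards $r_{ia}$ and transition probabilities $p_{iaj}\ge 0$, $\sum_j p_{iaj}=1$, and let $\gamma_j>0$ for $j\in X$. For a discount factor $\alpha\in(0,1)$ consider the discounted LP $$\min\sum_j\gamma_j\tilde v_j\quad\text{s.t.}\quad \sum_j(\delta_{ij}-\alpha p_{iaj})\tilde v_j\ge r_{ia}\ \ \forall (i,a),\qquad \tilde v\ge 0 .$$ With $\varepsilon=(1-\alpha)/\alpha$, the substitution $v_j=\frac{\varepsilon}{1+\varepsilon}\tilde v_j$ together with slack variables $\sigma_{ia}$ is a bijection from its feasible set onto that of $$\min\sum_j\gamma_jv_j\quad\text{s.t.}\quad\sum_j[(1+\varepsilon)\delta_{ij}-p_{iaj}]v_j-\sigma_{ia}=\varepsilon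 r_{ia}\ \ \forall(i,a),\qquad v\ge0,\ \sigma\ge 0,\tag{1}$$ and multiplies the objective by $\frac{\varepsilon}{1+\varepsilon}$. Problem (1) is the perturbed LP in the variable $x=(v,\sigma)$ with $A^{(0)}=(\delta_{ij}-p_{iaj}\mid -I)$, $A^{(1)}=(\delta_{ij}\mid 0)$, $b^{(0)}=0$, $b^{(1)}=(r_{ia})$, $c^{(0)}=(-\gamma,0)$, $c^{(1)}=0$. This perturbed LP satisfies $(H_0^*)$, $(H_1)$ and ES-1. Moreover, consider the long-run average LP $$\min\sum_j\gamma_jv^0_j\quad\text{s.t.}\quad\begin{cases}\sum_j[\delta_{ij}-p_{iaj}]v^0_j-\sigma^0_{ia}=0,\\ v^0_i+\sum_j[\delta_{ij}-p_{iaj}]v^1_j-\sigma^1_{ia}=r_{ia}\end{cases}\ \forall(i,a),\qquad v^0,\sigma^0,v^1,\sigma^1\ge0,\tag{2}$$ which is the program $\max\{\langle c^{(0)},x^0\rangle: A^{(0)}x^0=b^{(0)},\ A^{(0)}x^1+A^{(1)}x^0=b^{(1)},\ x^0\ge0,\ x^1\ge0\}$ for these data, with $x^0=(v^0,\sigma^0)$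 and $x^1=(v^1,\sigma^1)$. The set of the $x^0$-components of its feasible points is $\theta_1$. Problem (2), and problem (1) for every $\varepsilon>0$, have optimal solutions, and (2) is the limiting LP of (1): - every point of $\limsup_{\varepsilon\downarrow0}\theta^*(\varepsilon)$, where $\theta^*(\varepsilon)$ is the set of optimal solutions of (1), is the component $(v^0,\sigma^0)$ of an optimal solution of (2); - the optimal value of (1) converges to the optimal value of (2) as $\varepsilon\downarrow0$; - the component $(v^0,\sigma^0)$ of every optimal solution of (2) is feasible limiting optimal for (1). -/

import Mathlib

open Filter Topology

noncomputable section

/-! ### Optimization over a set -/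

/-- The set of minimizers of `f` over `F`. -/
def minimizers {V : Type*} (F : Set V) (f : V → ℝ) : Set V :=
  {x | x ∈ F ∧ ∀ y ∈ F, f x ≤ f y}

/-- The set of maximizers of `f` over `F`. -/
def maximizers {V : Type*} (F : Set V) (f : V → ℝ) : Set V :=
  {x | x ∈ F ∧ ∀ y ∈ F, f y ≤ f x}

/-- The value of `min {f x : x ∈ F}`, as an extended real (`⊤` if `F` is empty). -/
def minValue {V : Type*} (F : Set V) (f : V → ℝ) : EReal :=
  ⨅ x ∈ F, ((f x : ℝ) : EReal)

/-- The value of `max {f x : x ∈ F}`, as an extended real (`⊥` if `F` is empty). -/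
def maxValue {V : Type*} (F : Set V) (f : V → ℝ) : EReal :=
  ⨆ x ∈ F, ((f x : ℝ) : EReal)

/-! ### Limits of sets as `ε ↓ 0` (Painlevé–Kuratowski) -/

/-- The outer limit `limsup_{ε ↓ 0} C(ε)`: the points all of whose neighbourhoods meet `C(ε)` for
arbitrarily small `ε > 0`, that is, the limits of sequences `x_k ∈ C(ε_k)` with `ε_k ↓ 0`. -/
def outerLimit {V : Type*} [TopologicalSpace V] (C : ℝ → Set V) : Set V :=
  {x | ∀ U ∈ 𝓝 x, ∃ᶠ ε in 𝓝[>] (0 : ℝ), (C ε ∩ U).Nonempty}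

/-- The inner limit `liminf_{ε ↓ 0} C(ε)`: the points all of whose neighbourhoods meet `C(ε)` for
all sufficiently small `ε > 0`. -/
def innerLimit {V : Type*} [TopologicalSpace V] (C : ℝ → Set V) : Set V :=
  {x | ∀ U ∈ 𝓝 x, ∀ᶠ ε in 𝓝[>] (0 : ℝ), (C ε ∩ U).Nonempty}

/-! ### Perturbed linear programs -/

/-- The data of the family of linear programs
`max ⟨c₀ + ε c₁, x⟩` subject to `(A₀ + ε A₁) x = b₀ + ε b₁`, `x ≥ 0`,
with constraints indexed by `m` and variables indexed by `n`. -/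
structure PerturbedLP (m n : Type*) where
  A₀ : Matrix m n ℝ
  A₁ : Matrix m n ℝ
  b₀ : m → ℝ
  b₁ : m → ℝ
  c₀ : n → ℝ
  c₁ : n → ℝ

namespace PerturbedLP

variable {m n : Type*} [Fintype m] [Fintype n]

/-- The feasible set `θ(ε)`. -/
def feasible (P : PerturbedLP m n) (ε : ℝ) : Set (n → ℝ) :=
  {x | (P.A₀ + ε • P.A₁).mulVec x = P.b₀ + ε • P.b₁ ∧ ∀ j, 0 ≤ x j}

/-- The objective function `⟨c₀ + ε c₁, x⟩`. -/
def objective (P : PerturbedLP m n) (ε : ℝ) (x : n → ℝ) : ℝ :=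
  (P.c₀ + ε • P.c₁) ⬝ᵥ x

/-- The solution set `θ*(ε)`. -/
def solutions (P : PerturbedLP m n) (ε : ℝ) : Set (n → ℝ) :=
  maximizers (P.feasible ε) (P.objective ε)

/-- The optimal value `F*(ε)`. -/
def value (P : PerturbedLP m n) (ε : ℝ) : EReal :=
  maxValue (P.feasible ε) (P.objective ε)

/-- `x` is feasible limiting optimal: `x ∈ liminf_{ε ↓ 0} θ(ε)` and
`lim_{ε ↓ 0} F*(ε) = ⟨c₀, x⟩`. -/
def FeasibleLimitingOptimal (P : PerturbedLP m n) (x : n → ℝ) : Prop :=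
  x ∈ innerLimit P.feasible ∧
    Tendsto P.value (𝓝[>] (0 : ℝ)) (𝓝 (((P.c₀ ⬝ᵥ x : ℝ) : EReal)))

/-- Assumption `(H₀*)`: the solution sets are uniformly bounded for small `ε > 0`. -/
def H0star (P : PerturbedLP m n) : Prop :=
  ∃ γ₀ : ℝ, 0 < γ₀ ∧ ∃ B : Set (n → ℝ), Bornology.IsBounded B ∧
    ∀ ε : ℝ, 0 < ε → ε ≤ γ₀ → P.solutions ε ⊆ B

/-- Assumption `(H₁)`: the matrix `A₀` has full row rank. -/
def H1 (P : PerturbedLP m n) : Prop :=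
  P.A₀.rank = Fintype.card m

/-- The index set `J₀` of the variables that are positive at some point of `θ(0)`. -/
def J₀ (P : PerturbedLP m n) : Set n :=
  {j | ∃ x ∈ P.feasible 0, 0 < x j}

/-- The set `Θ₁` of the pairs `(x⁰, x¹)` with `x⁰ ∈ θ(0)`, `A₀ x¹ + A₁ x⁰ = b₁` and `x¹_j ≥ 0` for
`j ∉ J₀`. -/
def Theta₁ (P : PerturbedLP m n) : Set ((n → ℝ) × (n → ℝ)) :=
  {y | y.1 ∈ P.feasible 0 ∧ P.A₀.mulVec y.2 + P.A₁.mulVec y.1 = P.b₁ ∧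
    ∀ j, j ∉ P.J₀ → 0 ≤ y.2 j}

/-- The set `θ₁` of the first components of `Θ₁`. -/
def theta₁ (P : PerturbedLP m n) : Set (n → ℝ) :=
  Prod.fst '' P.Theta₁

/-- The extended Slater condition of order 1. -/
def ES1 (P : PerturbedLP m n) : Prop :=
  ∃ y ∈ P.Theta₁, (∀ j, j ∉ P.J₀ → 0 < y.2 j) ∧ ∀ j, j ∈ P.J₀ → 0 < y.1 j

/-- The feasible set of the program
`max ⟨c₀, x⁰⟩` subject to `A₀ x⁰ = b₀`, `A₀ x¹ + A₁ x⁰ = b₁`, `x⁰ ≥ 0`, `x¹ ≥ 0`. -/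
def ThetaTilde₁ (P : PerturbedLP m n) : Set ((n → ℝ) × (n → ℝ)) :=
  {y | P.A₀.mulVec y.1 = P.b₀ ∧ P.A₀.mulVec y.2 + P.A₁.mulVec y.1 = P.b₁ ∧
    (∀ j, 0 ≤ y.1 j) ∧ ∀ j, 0 ≤ y.2 j}

end PerturbedLP

/-! ### Markov decision processes -/

/-- A finite Markov decision process with state space `S`, action sets `A i`, immediate rewards
`r i a` and transition probabilities `p i a j`. -/
structure MDP (S : Type*) [Fintype S] (A : S → Type*) where
  r : ∀ i, A i → ℝ
  p : ∀ i, A i → S → ℝ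
  p_nonneg : ∀ i a j, 0 ≤ p i a j
  p_sum : ∀ i a, ∑ j, p i a j = 1

/-- The index set of the variables `(v, σ)`: `v` is indexed by the states and the slack variable
`σ` by the state-action pairs. -/
abbrev SlackIndex (S : Type*) (A : S → Type*) : Type _ := S ⊕ (Σ i, A i)

namespace MDP

variable {S : Type*} [Fintype S] [DecidableEq S] {A : S → Type*}

/-- The feasible set of the linear program of the `α`-discounted process:
`∑_j (δ_ij - α p_iaj) v_j ≥ r_ia` for all `(i, a)`, and `v ≥ 0`. -/
def discFeasible (M : MDP S A) (α : ℝ) : Set (S → ℝ) :=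
  {v | (∀ i a, M.r i a ≤ ∑ j, ((if i = j then 1 else 0) - α * M.p i a j) * v j) ∧ ∀ j, 0 ≤ v j}

/-- The feasible set of the rescaled discounted program with slack variables, in the unknown
`x = (v, σ)`: `∑_j ((1 + ε) δ_ij - p_iaj) v_j - σ_ia = ε r_ia` for all `(i, a)`, `v ≥ 0`,
`σ ≥ 0`. -/
def discSlackFeasible (M : MDP S A) (ε : ℝ) : Set (SlackIndex S A → ℝ) :=
  {x | (∀ i a, ∑ j, ((1 + ε) * (if i = j then 1 else 0) - M.p i a j) * x (Sum.inl j)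
        - x (Sum.inr ⟨i, a⟩) = ε * M.r i a) ∧
      (∀ j, 0 ≤ x (Sum.inl j)) ∧ ∀ s, 0 ≤ x (Sum.inr s)}

/-- The change of variables `v = ε / (1 + ε) ṽ`, completed by the slack variables. -/
def rescale (M : MDP S A) (ε : ℝ) (w : S → ℝ) : SlackIndex S A → ℝ :=
  Sum.elim (fun j => ε / (1 + ε) * w j)
    (fun s => ∑ j, ((1 + ε) * (if s.1 = j then 1 else 0) - M.p s.1 s.2 j) * (ε / (1 + ε) * w j)
      - ε * M.r s.1 s.2)

/-- The feasible set of the linear program of the long-run average process with slack variables,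
in the unknowns `y = (x⁰, x¹)`, `x⁰ = (v⁰, σ⁰)`, `x¹ = (v¹, σ¹)`:
`∑_j (δ_ij - p_iaj) v⁰_j - σ⁰_ia = 0` and `v⁰_i + ∑_j (δ_ij - p_iaj) v¹_j - σ¹_ia = r_ia` for all
`(i, a)`, and `v⁰, σ⁰, v¹, σ¹ ≥ 0`. -/
def avgSlackFeasible (M : MDP S A) :
    Set ((SlackIndex S A → ℝ) × (SlackIndex S A → ℝ)) :=
  {y | (∀ i a, ∑ j, ((if i = j then 1 else 0) - M.p i a j) * y.1 (Sum.inl j)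
        - y.1 (Sum.inr ⟨i, a⟩) = 0) ∧
      (∀ i a, y.1 (Sum.inl i)
        + ∑ j, ((if i = j then 1 else 0) - M.p i a j) * y.2 (Sum.inl j)
        - y.2 (Sum.inr ⟨i, a⟩) = M.r i a) ∧
      (∀ j, 0 ≤ y.1 (Sum.inl j)) ∧ (∀ s, 0 ≤ y.1 (Sum.inr s)) ∧
      (∀ j, 0 ≤ y.2 (Sum.inl j)) ∧ ∀ s, 0 ≤ y.2 (Sum.inr s)}

/-- The cost `∑_j γ_j v_j` of `x = (v, σ)`. -/
def cost {S : Type*} [Fintype S] {A : S → Type*} (γ : S → ℝ) (x : SlackIndex S A → ℝ) : ℝ :=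
  ∑ j, γ j * x (Sum.inl j)

/-- The perturbed linear program of the process: `A₀ = (δ_ij - p_iaj | -I)`, `A₁ = (δ_ij | 0)`,
`b₀ = 0`, `b₁ = (r_ia)`; minimizing `∑_j γ_j v_j` is maximizing with `c₀ = (-γ, 0)`, `c₁ = 0`. -/
def perturbedLP [∀ i, DecidableEq (A i)] (M : MDP S A) (γ : S → ℝ) :
    PerturbedLP (Σ i, A i) (SlackIndex S A) where
  A₀ := Matrix.fromCols
    (Matrix.of fun s j => (if s.1 = j then 1 else 0) - M.p s.1 s.2 j) (-1)
  A₁ := Matrix.fromCols (Matrix.of fun s j => if s.1 = j then 1 else 0) 0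
  b₀ := 0
  b₁ := fun s => M.r s.1 s.2
  c₀ := Sum.elim (fun j => -γ j) 0
  c₁ := 0

end MDP

end

/-!
If a point `z` of `θ(ε)` is near a limit point `x` of the sets `θ(ε)`, the quotient `(z - x) / ε`
satisfies the linear constraints that define `θ₁`, up to a small error. The quotients may be
unbounded, but linear images of polyhedra are closed, so `x` lies in `θ₁`. Conversely, full row rank
of `A₀` turns a first-order solution `x⁰ + ε x¹` into an exact solution `x⁰ + ε w(ε)` with
`w(ε) → x¹`, which is nonnegative when `(x⁰, x¹)` is a Slater point, and by convexity Slater points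
are dense in `Θ₁`. Hence `θ(ε)` converges to `θ₁`, and if the solution sets stay in a compact set,
the optimal values converge and optimal solutions accumulate at maximizers over `θ₁`.

For the discounted program a constant `v` dominating the rewards is feasible, and the costs are
positive, so `v`, and with it the slack, is bounded on the optimal solutions: this gives existence
and `(H₀*)`. The block `-I` gives `(H₁)`, and a large multiple of a point of `θ(0)` that is positive
on `J₀` gives ES-1. Since `b₀ = 0`, adding such a multiple to `x¹` makes it nonnegative everywhere,
which turns `θ₁` into the projection of the average-reward program.
-/

/-! ### Linear images of polyhedra are closed -/

theorem isBounded_submodule_inter_Ici {ι : Type*} [Finite ι] {W : Submodule ℝ (ι → ℝ)}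
    (hW : ∀ w ∈ W, 0 ≤ w → w = 0) (b : ι → ℝ) :
    Bornology.IsBounded ((W : Set (ι → ℝ)) ∩ Set.Ici b) := by
  cases nonempty_fintype ι
  rw [isBounded_iff_asymptoticCone_subset_singleton]
  intro d hd
  have hdW : d ∈ W := by
    have hdcone : d ∈ asymptoticCone ℝ (W : Set (ι → ℝ)) :=
      asymptoticCone_mono Set.inter_subset_left hd
    rwa [asymptoticCone_submodule, W.closed_of_finiteDimensional.closure_eq] at hdcone
  have hbd : (1 : ℝ) • d +ᵥ b ∈ Set.Ici b :=
    (convex_Ici b).smul_vadd_mem_of_isClosed_of_mem_asymptoticCone isClosed_Ici zero_le_one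
      (asymptoticCone_mono Set.inter_subset_right hd) Set.self_mem_Ici
  exact hW d hdW (by simpa using hbd)

theorem isClosed_lowerClosure_submodule_of_nonneg_eq_zero {ι : Type*} [Finite ι]
    {W : Submodule ℝ (ι → ℝ)} (hW : ∀ w ∈ W, 0 ≤ w → w = 0) :
    IsClosed (lowerClosure (W : Set (ι → ℝ)) : Set (ι → ℝ)) := by
  cases nonempty_fintype ι
  refine isClosed_iff_frequently.2 fun x hx => ?_
  set b : ι → ℝ := x - 1
  have hclosed : IsClosed
      (lowerClosure ((W : Set (ι → ℝ)) ∩ Set.Ici b) : Set (ι → ℝ)) :=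
    (W.closed_of_finiteDimensional.inter isClosed_Ici).lowerClosure_pi
      (isBounded_submodule_inter_Ici hW b).bddAbove
  have hb : ∀ᶠ y in 𝓝 x, b ≤ y := pi_Ici_mem_nhds fun i => by simp [b]
  refine lowerClosure_mono Set.inter_subset_left (hclosed.mem_of_frequently_of_tendsto
    ((hx.and_eventually hb).mono ?_) tendsto_id)
  rintro y ⟨⟨w, hw, hyw⟩, hby⟩
  exact ⟨w, ⟨hw, hby.trans hyw⟩, hyw⟩

theorem eventually_le_add_smul {ι : Type*} [Finite ι] {u w d : ι → ℝ} (hd : 0 ≤ d)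
    (h : ∀ i, d i = 0 → u i ≤ w i) : ∀ᶠ C : ℝ in atTop, u ≤ w + C • d := by
  refine eventually_all.2 fun i => ?_
  rcases (hd i).eq_or_lt with hi | hi
  · filter_upwards with C
    simpa [← hi] using h i hi.symm
  · exact (tendsto_atTop_add_const_left _ _
      (tendsto_id.atTop_mul_const hi)).eventually_ge_atTop (u i)

-- A nonzero `d ≥ 0` in `W` makes the constraints on the support of `d` void, since large multiples
-- of `d` can be added for free; this reduces the claim to fewer coordinates.
theorem isClosed_lowerClosure_submodule {ι : Type*} [Finite ι] (W : Submodule ℝ (ι → ℝ)) :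
    IsClosed (lowerClosure (W : Set (ι → ℝ)) : Set (ι → ℝ)) := by
  induction hn : Nat.card ι using Nat.strong_induction_on generalizing ι with
  | _ n ih =>
  by_cases hW : ∀ w ∈ W, 0 ≤ w → w = 0
  · exact isClosed_lowerClosure_submodule_of_nonneg_eq_zero hW
  push Not at hW
  obtain ⟨d, hdW, hd_nonneg, hd_ne⟩ := hW
  obtain ⟨t, ht⟩ := Function.ne_iff.1 hd_ne
  let ρ : (ι → ℝ) →ₗ[ℝ] ({i // d i = 0} → ℝ) := LinearMap.funLeft ℝ ℝ Subtype.val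
  have hρ : Continuous ρ := continuous_pi fun i => continuous_apply (i : ι)
  have hclosed := ih _ (hn ▸ Finite.card_subtype_lt ht) (W.map ρ) rfl
  convert hclosed.preimage hρ using 1
  ext u
  constructor
  · rintro ⟨w, hw, huw⟩
    exact ⟨ρ w, Submodule.mem_map_of_mem hw, fun i => huw i⟩
  · rintro ⟨_, ⟨w, hw, rfl⟩, huw⟩
    obtain ⟨C, hC⟩ := (eventually_le_add_smul hd_nonneg fun i hi => huw ⟨i, hi⟩).exists
    exact ⟨w + C • d, W.add_mem hw (W.smul_mem C hdW), hC⟩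

theorem isClosed_linearMap_image_setOf_nonneg {E F ι : Type*} [AddCommGroup E] [Module ℝ E]
    [AddCommGroup F] [Module ℝ F] [TopologicalSpace F] [IsTopologicalAddGroup F]
    [ContinuousSMul ℝ F] [T2Space F] [FiniteDimensional ℝ F] [Finite ι]
    (L : E →ₗ[ℝ] F) (T : E →ₗ[ℝ] ι → ℝ) : IsClosed (L '' {w | 0 ≤ T w}) := by
  obtain ⟨r, hr⟩ := L.rangeRestrict.exists_rightInverse_of_surjective L.range_rangeRestrict
  obtain ⟨g, hg⟩ := r.exists_extend
  have hLg : ∀ w, L (g (L w)) = L w := fun w => by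
    have h₁ : g (L w) = r (L.rangeRestrict w) := LinearMap.congr_fun hg (L.rangeRestrict w)
    have h₂ := congrArg Subtype.val (LinearMap.congr_fun hr (L.rangeRestrict w))
    rw [h₁]
    exact h₂
  have himage : L '' {w | 0 ≤ T w} = (LinearMap.range L : Set F) ∩ (-T ∘ₗ g) ⁻¹'
      (lowerClosure ((LinearMap.ker L).map T : Set (ι → ℝ)) : Set (ι → ℝ)) := by
    ext b
    constructor
    · rintro ⟨w, hw, rfl⟩
      refine ⟨⟨w, rfl⟩, T (w - g (L w)), ⟨_, by simp [hLg], rfl⟩, ?_⟩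
      simpa using hw
    · rintro ⟨⟨w, rfl⟩, _, ⟨k, hk, rfl⟩, hle⟩
      refine ⟨g (L w) + k, ?_, by simpa [hLg] using hk⟩
      simpa [neg_le_iff_add_nonneg'] using hle
  rw [himage]
  exact (LinearMap.range L).closed_of_finiteDimensional.inter
    ((isClosed_lowerClosure_submodule _).preimage (LinearMap.continuous_of_finiteDimensional _))

/-! ### Limits of sets and of maximization problems -/

section Limits

variable {V : Type*} [TopologicalSpace V] {C : ℝ → Set V} {x : V}

theorem outerLimit_mono {D : ℝ → Set V} (h : ∀ ε, C ε ⊆ D ε) : outerLimit C ⊆ outerLimit D :=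
  fun _ hx U hU => (hx U hU).mono fun ε hε => hε.mono (Set.inter_subset_inter_left _ (h ε))

theorem outerLimit_subset_of_isClosed {D : Set V} (hD : IsClosed D)
    (h : ∀ ε > 0, C ε ⊆ D) : outerLimit C ⊆ D := by
  refine fun x hx => isClosed_iff_nhds.1 hD x fun U hU => ?_
  obtain ⟨ε, ⟨z, hzC, hzU⟩, hε⟩ := ((hx U hU).and_eventually self_mem_nhdsWithin).exists
  exact ⟨z, hzU, h ε hε hzC⟩

theorem outerLimit_subset_of_isClosed_graph (hC : IsClosed {q : ℝ × V | q.2 ∈ C q.1}) :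
    outerLimit C ⊆ C 0 := by
  refine fun x hx => isClosed_iff_nhds.1 hC (0, x) fun N hN => ?_
  obtain ⟨I, hI, U, hU, hIU⟩ := mem_nhds_prod_iff.1 hN
  obtain ⟨ε, ⟨z, hzC, hzU⟩, hε⟩ :=
    ((hx U hU).and_eventually (nhdsWithin_le_nhds hI)).exists
  exact ⟨(ε, z), hIU ⟨hε, hzU⟩, hzC⟩

theorem isClosed_innerLimit (C : ℝ → Set V) : IsClosed (innerLimit C) := by
  refine isClosed_iff_nhds.2 fun x hx U hU => ?_
  obtain ⟨y, hyU, hy⟩ := hx _ (interior_mem_nhds.2 hU)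
  exact hy U (mem_interior_iff_mem_nhds.1 hyU)

theorem mem_innerLimit_of_tendsto {z : ℝ → V} (hz : Tendsto z (𝓝[>] 0) (𝓝 x))
    (hzC : ∀ᶠ ε in 𝓝[>] 0, z ε ∈ C ε) : x ∈ innerLimit C :=
  fun _ hU => ((hz.eventually_mem hU).and hzC).mono fun _ hε => ⟨_, hε.2, hε.1⟩

theorem exists_mem_outerLimit_tendsto_ultrafilter {K : Set V} (hK : IsCompact K)
    (hCK : ∀ᶠ ε in 𝓝[>] 0, C ε ⊆ K) {g : ℝ → V} (hg : ∀ᶠ ε in 𝓝[>] 0, g ε ∈ C ε)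
    {𝒰 : Ultrafilter ℝ} (h𝒰 : (𝒰 : Filter ℝ) ≤ 𝓝[>] 0) :
    ∃ x ∈ outerLimit C, Tendsto g 𝒰 (𝓝 x) := by
  have hgK : ∀ᶠ ε in 𝒰, g ε ∈ K :=
    ((hCK.and hg).filter_mono h𝒰).mono fun _ hε => hε.1 hε.2
  obtain ⟨x, -, hx⟩ := hK.ultrafilter_le_nhds (𝒰.map g) (le_principal_iff.2 hgK)
  have hgx : Tendsto g 𝒰 (𝓝 x) := hx
  exact ⟨x, fun U hU => (((hg.filter_mono h𝒰).and (hgx.eventually_mem hU)).mono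
    fun ε hε => ⟨g ε, hε⟩).frequently.filter_mono h𝒰, hgx⟩

theorem outerLimit_nonempty {K : Set V} (hK : IsCompact K) (hCK : ∀ᶠ ε in 𝓝[>] 0, C ε ⊆ K)
    (hC : ∀ᶠ ε in 𝓝[>] 0, (C ε).Nonempty) : (outerLimit C).Nonempty := by
  have : Nonempty V := hC.exists.elim fun _ h => h.to_type
  obtain ⟨g, hg⟩ := hC.choice
  obtain ⟨x, hx, -⟩ := exists_mem_outerLimit_tendsto_ultrafilter hK hCK hg
    (Ultrafilter.of_le (𝓝[>] (0 : ℝ)))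
  exact ⟨x, hx⟩

variable {C₀ : Set V} {f : ℝ → V → ℝ}

theorem outerLimit_maximizers_subset (hf : Continuous (Function.uncurry f))
    (houter : outerLimit C ⊆ C₀) (hinner : C₀ ⊆ innerLimit C) :
    outerLimit (fun ε => maximizers (C ε) (f ε)) ⊆ maximizers C₀ (f 0) := by
  refine fun x hx => ⟨houter (outerLimit_mono (fun _ _ h => h.1) hx), fun y hy => ?_⟩
  by_contra! hxy
  obtain ⟨c, hxc, hcy⟩ := exists_between hxy
  obtain ⟨I, hI, U, hU, hIU⟩ := mem_nhds_prod_iff.1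
    ((hf.tendsto (0, x)).eventually_lt_const hxc)
  obtain ⟨J, hJ, W, hW, hJW⟩ := mem_nhds_prod_iff.1
    ((hf.tendsto (0, y)).eventually_const_lt hcy)
  obtain ⟨ε, ⟨⟨u, hu, huU⟩, w, hw, hwW⟩, hεI, hεJ⟩ :=
    (((hx U hU).and_eventually (hinner hy W hW)).and_eventually
      (nhdsWithin_le_nhds (inter_mem hI hJ))).exists
  have hu_lt : f ε u < c := hIU (Set.mk_mem_prod hεI huU)
  have hlt_w : c < f ε w := hJW (Set.mk_mem_prod hεJ hwW)
  exact (hu_lt.trans hlt_w).not_ge (hu.2 w hw)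

theorem maxValue_eq_of_mem_maximizers {V : Type*} {F : Set V} {f : V → ℝ} {x : V}
    (hx : x ∈ maximizers F f) : maxValue F f = f x :=
  le_antisymm (iSup₂_le fun y hy => EReal.coe_le_coe_iff.2 (hx.2 y hy))
    (le_iSup₂ (f := fun y (_ : y ∈ F) => ((f y : ℝ) : EReal)) x hx.1)

theorem tendsto_maxValue (hf : Continuous (Function.uncurry f))
    (houter : outerLimit C ⊆ C₀) (hinner : C₀ ⊆ innerLimit C) {K : Set V} (hK : IsCompact K)
    (hmaxK : ∀ᶠ ε in 𝓝[>] 0, maximizers (C ε) (f ε) ⊆ K)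
    (hmax : ∀ᶠ ε in 𝓝[>] 0, (maximizers (C ε) (f ε)).Nonempty) :
    Tendsto (fun ε => maxValue (C ε) (f ε)) (𝓝[>] 0) (𝓝 (maxValue C₀ (f 0))) := by
  have : Nonempty V := hmax.exists.elim fun _ h => h.to_type
  obtain ⟨g, hg⟩ := hmax.choice
  refine tendsto_iff_ultrafilter _ _ _ |>.2 fun 𝒰 h𝒰 => ?_
  obtain ⟨x, hx, hgx⟩ := exists_mem_outerLimit_tendsto_ultrafilter hK hmaxK hg h𝒰
  rw [maxValue_eq_of_mem_maximizers (outerLimit_maximizers_subset hf houter hinner hx)]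
  have hlim : Tendsto (fun ε => f ε (g ε)) 𝒰 (𝓝 (f 0 x)) :=
    (hf.tendsto (0, x)).comp ((tendsto_id'.2 (h𝒰.trans nhdsWithin_le_nhds)).prodMk_nhds hgx)
  refine ((continuous_coe_real_ereal.tendsto _).comp hlim).congr' ?_
  filter_upwards [hg.filter_mono h𝒰] with ε hε using (maxValue_eq_of_mem_maximizers hε).symm

end Limits

/-! ### Perturbed linear programs -/

theorem exists_tendsto_add_smul_eq {𝕜 E F : Type*} [NontriviallyNormedField 𝕜]
    [NormedAddCommGroup E] [NormedSpace 𝕜 E] [NormedAddCommGroup F] [NormedSpace 𝕜 F]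
    [CompleteSpace F] (T₀ T₁ : E →L[𝕜] F) {R : F →L[𝕜] E} (hR : Function.RightInverse R T₀)
    (w₀ : E) : ∃ w : 𝕜 → E, Tendsto w (𝓝 0) (𝓝 w₀) ∧
      ∀ᶠ ε in 𝓝 0, T₀ (w ε) + ε • T₁ (w ε) = T₀ w₀ := by
  let G : 𝕜 → F →L[𝕜] F := fun ε => 1 + ε • T₁ ∘L R
  have hG : Tendsto G (𝓝 0) (𝓝 ((1 : (F →L[𝕜] F)ˣ) : F →L[𝕜] F)) := by
    have hcont : Continuous G := by fun_prop
    simpa [G] using hcont.tendsto 0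
  have hGinv := (NormedRing.inverse_continuousAt (1 : (F →L[𝕜] F)ˣ)).tendsto.comp hG
  refine ⟨fun ε => w₀ - ε • R (Ring.inverse (G ε) (T₁ w₀)), ?_, ?_⟩
  · have hlim := (tendsto_id (x := 𝓝 (0 : 𝕜))).smul
      (((R ∘L ContinuousLinearMap.apply 𝕜 F (T₁ w₀)).continuous.tendsto _).comp hGinv)
    simpa using hlim.const_sub w₀
  · filter_upwards [hG.eventually (Units.nhds 1)] with ε hε
    have hcancel : G ε (Ring.inverse (G ε) (T₁ w₀)) = T₁ w₀ :=
      DFunLike.congr_fun (Ring.mul_inverse_cancel _ hε) (T₁ w₀)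
    set u := Ring.inverse (G ε) (T₁ w₀)
    have hu : u + ε • T₁ (R u) = T₁ w₀ := hcancel
    rw [map_sub, map_smul, hR u, map_sub, map_smul, ← hu]
    module

namespace PerturbedLP

variable {m n : Type*} [Fintype n] {P : PerturbedLP m n} {ε : ℝ} {x : n → ℝ}

theorem mem_feasible : x ∈ P.feasible ε ↔
    P.A₀.mulVec x + ε • P.A₁.mulVec x = P.b₀ + ε • P.b₁ ∧ 0 ≤ x := by
  rw [← Matrix.smul_mulVec, ← Matrix.add_mulVec]
  rfl

theorem mem_feasible_zero : x ∈ P.feasible 0 ↔ P.A₀.mulVec x = P.b₀ ∧ 0 ≤ x := by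
  simp [mem_feasible]

theorem isClosed_graph_feasible (P : PerturbedLP m n) :
    IsClosed {q : ℝ × (n → ℝ) | q.2 ∈ P.feasible q.1} := by
  simp only [mem_feasible, Set.ofPred_and]
  exact (isClosed_eq (by fun_prop) (by fun_prop)).inter
    (isClosed_le continuous_const continuous_snd)

theorem isClosed_feasible (P : PerturbedLP m n) (ε : ℝ) : IsClosed (P.feasible ε) :=
  P.isClosed_graph_feasible.preimage (Continuous.prodMk_right ε)

theorem convex_feasible (P : PerturbedLP m n) (ε : ℝ) : Convex ℝ (P.feasible ε) :=
  ((convex_singleton _).linear_preimage (P.A₀ + ε • P.A₁).mulVecLin).inter (convex_Ici 0)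

theorem eq_zero_of_notMem_J₀ {j : n} (hj : j ∉ P.J₀) (hx : x ∈ P.feasible 0) : x j = 0 :=
  le_antisymm (not_lt.1 fun h => hj ⟨x, hx, h⟩) (hx.2 j)

theorem outerLimit_feasible_subset_feasible_zero (P : PerturbedLP m n) :
    outerLimit P.feasible ⊆ P.feasible 0 :=
  outerLimit_subset_of_isClosed_graph P.isClosed_graph_feasible

-- For `z ∈ θ(ε)` the difference quotient `(z - x) / ε` satisfies the constraints on `x¹`, with
-- `A₁ z` in place of `A₁ x`; although it may be unbounded as `ε ↓ 0`, the constraints pass to the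
-- limit because linear images of polyhedra are closed.
theorem outerLimit_feasible_subset_theta₁ [Finite m] (P : PerturbedLP m n) :
    outerLimit P.feasible ⊆ P.theta₁ := by
  intro x hx
  have hx₀ : x ∈ P.feasible 0 := P.outerLimit_feasible_subset_feasible_zero hx
  let T : (n → ℝ) →ₗ[ℝ] ({j // j ∉ P.J₀} → ℝ) := LinearMap.funLeft ℝ ℝ Subtype.val
  have hclosed : IsClosed ((fun z => P.b₁ - P.A₁.mulVec z) ⁻¹'
      (P.A₀.mulVecLin '' {w | 0 ≤ T w})) :=
    (isClosed_linearMap_image_setOf_nonneg _ _).preimage (by fun_prop)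
  have hquot : ∀ ε > 0, P.feasible ε ⊆ (fun z => P.b₁ - P.A₁.mulVec z) ⁻¹'
      (P.A₀.mulVecLin '' {w | 0 ≤ T w}) := by
    intro ε hε z hz
    refine ⟨ε⁻¹ • (z - x), fun j => ?_, ?_⟩
    · have hzj : 0 ≤ z j := hz.2 j
      have hxj : x j = 0 := eq_zero_of_notMem_J₀ j.2 hx₀
      simpa [T, LinearMap.funLeft, hxj] using mul_nonneg (inv_nonneg.2 hε.le) hzj
    · have hAz : P.A₀.mulVec z - P.b₀ = ε • (P.b₁ - P.A₁.mulVec z) := by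
        rw [smul_sub, eq_sub_of_add_eq (mem_feasible.1 hz).1]
        abel
      rw [Matrix.mulVecLin_apply, Matrix.mulVec_smul, Matrix.mulVec_sub,
        (mem_feasible_zero.1 hx₀).1, hAz, inv_smul_smul₀ hε.ne']
  obtain ⟨w, hw, hAw⟩ := outerLimit_subset_of_isClosed hclosed hquot hx
  exact ⟨(x, w), ⟨hx₀, eq_sub_iff_add_eq.1 hAw, fun j hj => hw ⟨j, hj⟩⟩, rfl⟩

/-- The pairs `(x⁰, x¹)` witnessing the extended Slater condition of order 1: those of `Θ₁` with
`x⁰_j > 0` for `j ∈ J₀` and `x¹_j > 0` for `j ∉ J₀`. -/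
def slaterSet (P : PerturbedLP m n) : Set ((n → ℝ) × (n → ℝ)) :=
  {y ∈ P.Theta₁ | (∀ j, j ∉ P.J₀ → 0 < y.2 j) ∧ ∀ j, j ∈ P.J₀ → 0 < y.1 j}

theorem convex_Theta₁ (P : PerturbedLP m n) : Convex ℝ P.Theta₁ := by
  rintro y ⟨hy, hyeq, hyJ⟩ z ⟨hz, hzeq, hzJ⟩ a b ha hb hab
  refine ⟨P.convex_feasible 0 hy hz ha hb hab, ?_, fun j hj =>
    add_nonneg (mul_nonneg ha (hyJ j hj)) (mul_nonneg hb (hzJ j hj))⟩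
  calc P.A₀.mulVec (a • y.2 + b • z.2) + P.A₁.mulVec (a • y.1 + b • z.1)
      = a • (P.A₀.mulVec y.2 + P.A₁.mulVec y.1) + b • (P.A₀.mulVec z.2 + P.A₁.mulVec z.1) := by
        simp only [Matrix.mulVec_add, Matrix.mulVec_smul]
        module
    _ = P.b₁ := by rw [hyeq, hzeq, ← add_smul, hab, one_smul]

theorem smul_add_smul_mem_slaterSet {y z : (n → ℝ) × (n → ℝ)} (hy : y ∈ P.Theta₁)
    (hz : z ∈ P.slaterSet) {a b : ℝ} (ha : 0 ≤ a) (hb : 0 < b) (hab : a + b = 1) :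
    a • y + b • z ∈ P.slaterSet :=
  ⟨P.convex_Theta₁ hy hz.1 ha hb.le hab,
    fun j hj => add_pos_of_nonneg_of_pos (mul_nonneg ha (hy.2.2 j hj)) (mul_pos hb (hz.2.1 j hj)),
    fun j hj => add_pos_of_nonneg_of_pos (mul_nonneg ha (hy.1.2 j)) (mul_pos hb (hz.2.2 j hj))⟩

theorem H1.surjective_mulVec [Fintype m] (h₁ : P.H1) : Function.Surjective P.A₀.mulVec :=
  LinearMap.range_eq_top.1 (Submodule.eq_top_of_finrank_eq
    ((show Module.finrank ℝ (LinearMap.range P.A₀.mulVecLin) = _ from h₁).trans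
      (Module.finrank_fintype_fun_eq_card ℝ).symm))

theorem H1.exists_tendsto_mulVec_add_smul_eq [Fintype m] (h₁ : P.H1) (w₀ : n → ℝ) :
    ∃ w : ℝ → n → ℝ, Tendsto w (𝓝 0) (𝓝 w₀) ∧
      ∀ᶠ ε in 𝓝 0, P.A₀.mulVec (w ε) + ε • P.A₁.mulVec (w ε) = P.A₀.mulVec w₀ := by
  obtain ⟨R, hR⟩ := P.A₀.mulVecLin.exists_rightInverse_of_surjective
    (LinearMap.range_eq_top.2 h₁.surjective_mulVec)
  exact exists_tendsto_add_smul_eq P.A₀.mulVecLin.toContinuousLinearMap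
    P.A₁.mulVecLin.toContinuousLinearMap (R := R.toContinuousLinearMap)
    (LinearMap.congr_fun hR) w₀

-- With `w(ε) → x¹` and `(A₀ + ε A₁) w(ε) = A₀ x¹`, the point `x⁰ + ε w(ε)` solves the perturbed
-- equations exactly, and the strict inequalities in the Slater condition make it nonnegative.
theorem fst_mem_innerLimit_feasible_of_mem_slaterSet [Fintype m] (h₁ : P.H1)
    {y : (n → ℝ) × (n → ℝ)} (hy : y ∈ P.slaterSet) : y.1 ∈ innerLimit P.feasible := by
  obtain ⟨⟨hy₀, hyeq, -⟩, hpos₁, hpos₀⟩ := hy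
  obtain ⟨w, hw, hweq⟩ := h₁.exists_tendsto_mulVec_add_smul_eq y.2
  have hpath : Tendsto (fun ε => y.1 + ε • w ε) (𝓝 0) (𝓝 y.1) := by
    simpa using (tendsto_id.smul hw).const_add y.1
  have hnonneg : ∀ᶠ ε in 𝓝[>] (0 : ℝ), 0 ≤ y.1 + ε • w ε := by
    refine eventually_all.2 fun j => ?_
    by_cases hj : j ∈ P.J₀
    · exact (((tendsto_pi_nhds.1 hpath j).eventually_const_lt (hpos₀ j hj)).filter_mono
        nhdsWithin_le_nhds).mono fun ε hε => hε.le
    · filter_upwards [((tendsto_pi_nhds.1 hw j).eventually_const_lt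
        (hpos₁ j hj)).filter_mono nhdsWithin_le_nhds, self_mem_nhdsWithin] with ε hwε hε
      exact add_nonneg (hy₀.2 j) (mul_nonneg (Set.mem_Ioi.1 hε).le hwε.le)
  refine mem_innerLimit_of_tendsto (hpath.mono_left nhdsWithin_le_nhds) ?_
  filter_upwards [hnonneg, hweq.filter_mono nhdsWithin_le_nhds] with ε hε hwε
  refine mem_feasible.2 ⟨?_, hε⟩
  calc P.A₀.mulVec (y.1 + ε • w ε) + ε • P.A₁.mulVec (y.1 + ε • w ε)
      = P.A₀.mulVec y.1
        + ε • ((P.A₀.mulVec (w ε) + ε • P.A₁.mulVec (w ε)) + P.A₁.mulVec y.1) := by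
        simp only [Matrix.mulVec_add, Matrix.mulVec_smul]
        module
    _ = P.b₀ + ε • P.b₁ := by rw [hwε, hyeq, (mem_feasible_zero.1 hy₀).1]

theorem theta₁_subset_innerLimit_feasible [Fintype m] (h₁ : P.H1) (hES : P.ES1) :
    P.theta₁ ⊆ innerLimit P.feasible := by
  rintro _ ⟨y, hy, rfl⟩
  obtain ⟨z, hz⟩ : P.slaterSet.Nonempty := hES
  have hsegment : Tendsto (fun t : ℝ => ((1 - t) • y + t • z).1) (𝓝[>] 0) (𝓝 y.1) := by
    have hcont : Continuous fun t : ℝ => ((1 - t) • y + t • z).1 := by fun_prop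
    simpa using (hcont.tendsto 0).mono_left nhdsWithin_le_nhds
  refine (isClosed_innerLimit P.feasible).mem_of_tendsto hsegment ?_
  filter_upwards [Ioc_mem_nhdsGT one_pos] with t ht
  exact fst_mem_innerLimit_feasible_of_mem_slaterSet h₁ (smul_add_smul_mem_slaterSet hy hz
    (sub_nonneg.2 ht.2) ht.1 (sub_add_cancel 1 t))

theorem continuous_uncurry_objective (P : PerturbedLP m n) :
    Continuous (Function.uncurry P.objective) := by
  unfold objective
  fun_prop

theorem objective_zero (P : PerturbedLP m n) (x : n → ℝ) : P.objective 0 x = P.c₀ ⬝ᵥ x := by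
  simp [objective]

theorem H0star.exists_isCompact (h₀ : P.H0star) :
    ∃ K, IsCompact K ∧ ∀ᶠ ε in 𝓝[>] 0, P.solutions ε ⊆ K := by
  obtain ⟨γ₀, hγ₀, B, hB, hsub⟩ := h₀
  refine ⟨closure B, hB.isCompact_closure, ?_⟩
  filter_upwards [Ioc_mem_nhdsGT hγ₀] with ε hε
  exact (hsub ε hε.1 hε.2).trans subset_closure

section Limiting

variable [Fintype m]

theorem outerLimit_solutions_subset (h₁ : P.H1) (hES : P.ES1) :
    outerLimit P.solutions ⊆ maximizers P.theta₁ (P.objective 0) :=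
  outerLimit_maximizers_subset P.continuous_uncurry_objective
    P.outerLimit_feasible_subset_theta₁ (theta₁_subset_innerLimit_feasible h₁ hES)

theorem maximizers_theta₁_nonempty (h₀ : P.H0star) (h₁ : P.H1) (hES : P.ES1)
    (hsol : ∀ᶠ ε in 𝓝[>] 0, (P.solutions ε).Nonempty) :
    (maximizers P.theta₁ (P.objective 0)).Nonempty := by
  obtain ⟨K, hK, hsub⟩ := h₀.exists_isCompact
  exact (outerLimit_nonempty hK hsub hsol).mono (outerLimit_solutions_subset h₁ hES)

theorem tendsto_value (h₀ : P.H0star) (h₁ : P.H1) (hES : P.ES1)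
    (hsol : ∀ᶠ ε in 𝓝[>] 0, (P.solutions ε).Nonempty) :
    Tendsto P.value (𝓝[>] 0) (𝓝 (maxValue P.theta₁ (P.objective 0))) := by
  obtain ⟨K, hK, hsub⟩ := h₀.exists_isCompact
  exact tendsto_maxValue P.continuous_uncurry_objective P.outerLimit_feasible_subset_theta₁
    (theta₁_subset_innerLimit_feasible h₁ hES) hK hsub hsol

theorem feasibleLimitingOptimal_of_mem_maximizers_theta₁ (h₀ : P.H0star) (h₁ : P.H1)
    (hES : P.ES1) (hsol : ∀ᶠ ε in 𝓝[>] 0, (P.solutions ε).Nonempty)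
    (hx : x ∈ maximizers P.theta₁ (P.objective 0)) : P.FeasibleLimitingOptimal x := by
  refine ⟨theta₁_subset_innerLimit_feasible h₁ hES hx.1, ?_⟩
  rw [← P.objective_zero, ← maxValue_eq_of_mem_maximizers hx]
  exact tendsto_value h₀ h₁ hES hsol

end Limiting

theorem exists_feasible_zero_pos (hb : P.b₀ = 0) :
    ∃ x ∈ P.feasible 0, ∀ j ∈ P.J₀, 0 < x j := by
  have h : ∀ j, ∃ x ∈ P.feasible 0, j ∈ P.J₀ → 0 < x j := fun j => by
    by_cases hj : j ∈ P.J₀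
    · obtain ⟨x, hx, hxj⟩ := hj
      exact ⟨x, hx, fun _ => hxj⟩
    · exact ⟨0, mem_feasible_zero.2 ⟨by simp [hb], le_rfl⟩, fun h => (hj h).elim⟩
  choose x hx hxpos using h
  refine ⟨∑ k, x k, mem_feasible_zero.2
    ⟨?_, Finset.sum_nonneg fun k _ => (hx k).2⟩, fun j hj => ?_⟩
  · rw [Matrix.mulVec_sum, hb]
    exact Finset.sum_eq_zero fun k _ => by rw [(mem_feasible_zero.1 (hx k)).1, hb]
  · have hle : x j ≤ ∑ k, x k :=
      Finset.single_le_sum (fun k _ => (hx k).2) (Finset.mem_univ j)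
    exact (hxpos j hj).trans_le (hle j)

-- Adding to `x¹` a large multiple of a point of `θ(0)` that is positive on `J₀` makes it
-- nonnegative without affecting `A₀ x¹`.
theorem theta₁_eq_image_ThetaTilde₁ (hb : P.b₀ = 0) : P.theta₁ = Prod.fst '' P.ThetaTilde₁ := by
  apply Set.Subset.antisymm
  · rintro _ ⟨⟨x, w⟩, ⟨hx, hw, hwJ⟩, rfl⟩
    obtain ⟨z, hz, hzpos⟩ := exists_feasible_zero_pos hb
    have hz₀ : P.A₀.mulVec z = 0 := (mem_feasible_zero.1 hz).1.trans hb
    obtain ⟨C, hC⟩ := (eventually_le_add_smul (u := 0) (w := w) hz.2 fun j hj =>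
      hwJ j fun hjJ => (hzpos j hjJ).ne' hj).exists
    refine ⟨(x, w + C • z), ⟨(mem_feasible_zero.1 hx).1, ?_, hx.2, hC⟩, rfl⟩
    simpa [Matrix.mulVec_add, Matrix.mulVec_smul, hz₀] using hw
  · rintro _ ⟨⟨x, w⟩, ⟨hx, hw, hx0, hw0⟩, rfl⟩
    exact ⟨(x, w), ⟨mem_feasible_zero.2 ⟨hx, hx0⟩, hw, fun j _ => hw0 j⟩, rfl⟩

end PerturbedLP

/-! ### Transfer of optimization problems -/

section Transfer

variable {U V : Type*}

theorem maximizers_neg (F : Set V) (f : V → ℝ) :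
    maximizers F (fun x => -f x) = minimizers F f := by
  simp only [maximizers, minimizers, neg_le_neg_iff]

theorem maxValue_neg (F : Set V) (f : V → ℝ) :
    maxValue F (fun x => -f x) = -minValue F f := by
  simp only [maxValue, minValue, EReal.coe_neg]
  refine le_antisymm (iSup₂_le fun x hx => EReal.neg_le_neg_iff.2 (iInf₂_le x hx))
    (EReal.neg_le_of_neg_le (le_iInf₂ fun x hx => EReal.neg_le_of_neg_le ?_))
  exact le_iSup₂ (f := fun x (_ : x ∈ F) => -((f x : ℝ) : EReal)) x hx

theorem image_minimizers_comp (g : U → V) (F : Set U) (f : V → ℝ) :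
    g '' minimizers F (fun x => f (g x)) = minimizers (g '' F) f := by
  ext y
  constructor
  · rintro ⟨x, hx, rfl⟩
    exact ⟨Set.mem_image_of_mem g hx.1, Set.forall_mem_image.2 hx.2⟩
  · rintro ⟨⟨x, hx, rfl⟩, hmin⟩
    exact ⟨x, ⟨hx, fun z hz => hmin _ (Set.mem_image_of_mem g hz)⟩, rfl⟩

theorem minValue_image (g : U → V) (F : Set U) (f : V → ℝ) :
    minValue (g '' F) f = minValue F fun x => f (g x) :=
  iInf_image

end Transfer

/-! ### Markov decision processes -/

namespace MDP

variable {S : Type*} [Fintype S] {A : S → Type*}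

section ChangeOfVariables

variable [DecidableEq S] {M : MDP S A} {ε : ℝ}

theorem sum_mul_ite_sub_mul (c : ℝ) (i : S) (q v : S → ℝ) :
    ∑ j, (c * (if i = j then 1 else 0) - q j) * v j = c * v i - q ⬝ᵥ v := by
  simp [dotProduct, sub_mul, Finset.sum_sub_distrib]

theorem mem_discFeasible {α : ℝ} {v : S → ℝ} : v ∈ M.discFeasible α ↔
    (∀ i a, M.r i a ≤ v i - α * (M.p i a ⬝ᵥ v)) ∧ 0 ≤ v := by
  simp [discFeasible, dotProduct, sub_mul, Finset.sum_sub_distrib, Finset.mul_sum, mul_assoc,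
    Pi.le_def]

theorem mem_discSlackFeasible {x : SlackIndex S A → ℝ} : x ∈ M.discSlackFeasible ε ↔
    (∀ i a, (1 + ε) * x (.inl i) - M.p i a ⬝ᵥ (x ∘ Sum.inl) - x (.inr ⟨i, a⟩) = ε * M.r i a) ∧
      0 ≤ x := by
  simp [discSlackFeasible, dotProduct, sub_mul, Finset.sum_sub_distrib, Pi.le_def]

theorem mem_avgSlackFeasible {y : (SlackIndex S A → ℝ) × (SlackIndex S A → ℝ)} :
    y ∈ M.avgSlackFeasible ↔
      (∀ i a, y.1 (.inl i) - M.p i a ⬝ᵥ (y.1 ∘ Sum.inl) - y.1 (.inr ⟨i, a⟩) = 0) ∧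
      (∀ i a, y.1 (.inl i) + (y.2 (.inl i) - M.p i a ⬝ᵥ (y.2 ∘ Sum.inl)) - y.2 (.inr ⟨i, a⟩)
        = M.r i a) ∧ 0 ≤ y.1 ∧ 0 ≤ y.2 := by
  simp [avgSlackFeasible, dotProduct, sub_mul, Finset.sum_sub_distrib, Pi.le_def, and_assoc]

theorem rescale_inr (hε : 1 + ε ≠ 0) (w : S → ℝ) (s : Σ i, A i) :
    M.rescale ε w (.inr s)
      = ε * (w s.1 - (1 + ε)⁻¹ * (M.p s.1 s.2 ⬝ᵥ w) - M.r s.1 s.2) := by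
  have hsum := sum_mul_ite_sub_mul (1 + ε) s.1 (M.p s.1 s.2) ((ε / (1 + ε)) • w)
  rw [dotProduct_smul] at hsum
  simp only [Pi.smul_apply, smul_eq_mul] at hsum
  rw [rescale, Sum.elim_inr, hsum]
  field_simp

theorem rescale_mem_discSlackFeasible_iff (hε : 0 < ε) {w : S → ℝ} :
    M.rescale ε w ∈ M.discSlackFeasible ε ↔ w ∈ M.discFeasible (1 + ε)⁻¹ := by
  have heq : ∀ i a, (1 + ε) * M.rescale ε w (.inl i)
      - M.p i a ⬝ᵥ (M.rescale ε w ∘ Sum.inl) - M.rescale ε w (.inr ⟨i, a⟩) = ε * M.r i a := by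
    intro i a
    have hdot : M.p i a ⬝ᵥ (M.rescale ε w ∘ Sum.inl) = ε / (1 + ε) * (M.p i a ⬝ᵥ w) :=
      dotProduct_smul (ε / (1 + ε)) (M.p i a) w
    rw [hdot, rescale_inr (by positivity), rescale, Sum.elim_inl]
    field_simp
    ring
  have hscale : 0 < ε / (1 + ε) := by positivity
  have hv : (∀ j, 0 ≤ M.rescale ε w (.inl j)) ↔ 0 ≤ w :=
    forall_congr' fun j => mul_nonneg_iff_of_pos_left hscale
  have hσ : (∀ s, 0 ≤ M.rescale ε w (.inr s)) ↔
      ∀ i a, M.r i a ≤ w i - (1 + ε)⁻¹ * (M.p i a ⬝ᵥ w) := by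
    simp [rescale_inr (M := M) (show 1 + ε ≠ 0 by positivity), hε,
      Sigma.forall]
  rw [mem_discSlackFeasible, mem_discFeasible, Pi.le_def, Sum.forall, ← hσ, ← hv]
  exact (and_iff_right heq).trans and_comm

theorem rescale_smul_inl_of_mem_discSlackFeasible (hε : 0 < ε) {x : SlackIndex S A → ℝ}
    (hx : x ∈ M.discSlackFeasible ε) :
    M.rescale ε (((1 + ε) / ε) • (x ∘ Sum.inl)) = x := by
  ext (j | ⟨i, a⟩)
  · simp only [rescale, Sum.elim_inl, Pi.smul_apply, Function.comp_apply, smul_eq_mul]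
    field_simp
  · have hia := (mem_discSlackFeasible.1 hx).1 i a
    rw [rescale_inr (by positivity), dotProduct_smul]
    simp only [Pi.smul_apply, Function.comp_apply, smul_eq_mul]
    field_simp
    linarith

theorem rescale_injective (hε : 0 < ε) : Function.Injective (M.rescale ε) := by
  refine fun w w' h => funext fun j => ?_
  have hscale : ε / (1 + ε) ≠ 0 := by positivity
  exact mul_left_cancel₀ hscale (congrFun h (.inl j))

theorem bijOn_rescale (M : MDP S A) (hε : 0 < ε) :
    Set.BijOn (M.rescale ε) (M.discFeasible (1 + ε)⁻¹) (M.discSlackFeasible ε) := by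
  refine ⟨fun w hw => (rescale_mem_discSlackFeasible_iff hε).2 hw,
    (rescale_injective hε).injOn, fun x hx => ?_⟩
  have hrescale := rescale_smul_inl_of_mem_discSlackFeasible hε hx
  exact ⟨_, (rescale_mem_discSlackFeasible_iff hε).1 (by rwa [hrescale]), hrescale⟩

theorem cost_rescale (M : MDP S A) (γ : S → ℝ) (ε : ℝ) (w : S → ℝ) :
    cost γ (M.rescale ε w) = ε / (1 + ε) * ∑ j, γ j * w j := by
  simp only [cost, rescale, Sum.elim_inl, Finset.mul_sum, mul_left_comm]

end ChangeOfVariables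

section FeasiblePoints

theorem continuous_cost (γ : S → ℝ) : Continuous (cost (A := A) γ) := by
  unfold cost
  fun_prop

variable [DecidableEq S] (M : MDP S A) {γ : S → ℝ}

theorem const_mem_discSlackFeasible {ε R : ℝ} (hR : 0 ≤ R)
    (hr : ∀ i a, ε * M.r i a ≤ ε * R) :
    Sum.elim (fun _ => R) (fun s => ε * (R - M.r s.1 s.2)) ∈ M.discSlackFeasible ε := by
  refine mem_discSlackFeasible.2 ⟨fun i a => ?_, Sum.forall.2 ⟨fun _ => hR, fun s => ?_⟩⟩
  · have hconst : M.p i a ⬝ᵥ (fun _ => R) = R := by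
      rw [dotProduct, ← Finset.sum_mul, M.p_sum, one_mul]
    simp only [Sum.elim_comp_inl, Sum.elim_inl, Sum.elim_inr, hconst]
    ring
  · simpa [mul_sub] using hr s.1 s.2

theorem exists_discSlackFeasible_cost_le [∀ i, Finite (A i)] (γ : S → ℝ) :
    ∃ c, ∀ ε : ℝ, 0 ≤ ε → ∃ x ∈ M.discSlackFeasible ε, cost γ x ≤ c := by
  obtain ⟨R, hR⟩ := Finite.exists_le fun s : Σ i, A i => M.r s.1 s.2
  refine ⟨∑ j, γ j * max R 0, fun ε hε => ⟨_, M.const_mem_discSlackFeasible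
    (le_max_right R 0) fun i a => ?_, le_rfl⟩⟩
  exact mul_le_mul_of_nonneg_left ((hR ⟨i, a⟩).trans (le_max_left R 0)) hε

theorem exists_mem_Icc_of_cost_le (hγ : ∀ j, 0 < γ j) (E c : ℝ) :
    ∃ u, ∀ ε ∈ Set.Icc 0 E, ∀ x ∈ M.discSlackFeasible ε, cost γ x ≤ c → x ∈ Set.Icc 0 u := by
  refine ⟨Sum.elim (fun j => c / γ j) fun s => (1 + E) * (c / γ s.1) + E * |M.r s.1 s.2|,
    fun ε ⟨hε, hεE⟩ x hx hxc => ?_⟩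
  obtain ⟨heq, hx₀⟩ := mem_discSlackFeasible.1 hx
  have hv : ∀ j, x (.inl j) ≤ c / γ j := fun j => (le_div_iff₀' (hγ j)).2 <|
    (Finset.single_le_sum (f := fun j => γ j * x (.inl j))
      (fun k _ => mul_nonneg (hγ k).le (hx₀ _)) (Finset.mem_univ j)).trans hxc
  refine ⟨hx₀, Sum.forall.2 ⟨hv, fun ⟨i, a⟩ => ?_⟩⟩
  have hdot : 0 ≤ M.p i a ⬝ᵥ (x ∘ Sum.inl) :=
    dotProduct_nonneg_of_nonneg (M.p_nonneg i a) fun j => hx₀ (.inl j)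
  have hvi : (1 + ε) * x (.inl i) ≤ (1 + E) * (c / γ i) :=
    mul_le_mul (by gcongr) (hv i) (hx₀ _) (by linarith)
  have hri : -(ε * M.r i a) ≤ E * |M.r i a| :=
    calc -(ε * M.r i a) ≤ ε * |M.r i a| := by
          rw [← mul_neg]
          exact mul_le_mul_of_nonneg_left (neg_le_abs _) hε
      _ ≤ E * |M.r i a| := by gcongr
  rw [Sum.elim_inr]
  linarith [heq i a]

end FeasiblePoints

section PerturbedLP

variable [DecidableEq S] [∀ i, Fintype (A i)] [∀ i, DecidableEq (A i)] (M : MDP S A)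
  (γ : S → ℝ)

theorem perturbedLP_objective (ε : ℝ) :
    (M.perturbedLP γ).objective ε = fun x => -cost γ x := by
  ext x
  simp [PerturbedLP.objective, perturbedLP, dotProduct, cost]

theorem perturbedLP_A₀_mulVec (x : SlackIndex S A → ℝ) (s : Σ i, A i) :
    (M.perturbedLP γ).A₀.mulVec x s
      = x (.inl s.1) - M.p s.1 s.2 ⬝ᵥ (x ∘ Sum.inl) - x (.inr s) := by
  rw [sub_eq_add_neg _ (x (.inr s))]
  simp [perturbedLP, Matrix.mulVec, dotProduct, sub_mul, Finset.sum_sub_distrib,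
    Matrix.one_apply]

theorem perturbedLP_A₁_mulVec (x : SlackIndex S A → ℝ) (s : Σ i, A i) :
    (M.perturbedLP γ).A₁.mulVec x s = x (.inl s.1) := by
  simp [perturbedLP, Matrix.mulVec, dotProduct]

theorem perturbedLP_feasible (ε : ℝ) :
    (M.perturbedLP γ).feasible ε = M.discSlackFeasible ε := by
  ext x
  rw [mem_discSlackFeasible, PerturbedLP.mem_feasible, funext_iff, Sigma.forall]
  refine and_congr_left' (forall₂_congr fun i a => ?_)
  simp only [Pi.add_apply, Pi.smul_apply, smul_eq_mul, perturbedLP_A₀_mulVec,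
    perturbedLP_A₁_mulVec]
  simp only [perturbedLP, Pi.zero_apply]
  constructor <;> intro h <;> linarith

theorem perturbedLP_ThetaTilde₁ : (M.perturbedLP γ).ThetaTilde₁ = M.avgSlackFeasible := by
  ext y
  rw [mem_avgSlackFeasible]
  simp only [PerturbedLP.ThetaTilde₁, Set.mem_ofPred_eq, funext_iff, Sigma.forall,
    Pi.add_apply, perturbedLP_A₀_mulVec, perturbedLP_A₁_mulVec]
  refine and_congr_right' (and_congr_left' (forall₂_congr fun i a => ?_))
  simp only [perturbedLP]
  constructor <;> intro h <;> linarith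

theorem perturbedLP_theta₁ :
    (M.perturbedLP γ).theta₁ = Prod.fst '' M.avgSlackFeasible := by
  rw [PerturbedLP.theta₁_eq_image_ThetaTilde₁ rfl, perturbedLP_ThetaTilde₁]

theorem perturbedLP_solutions :
    (M.perturbedLP γ).solutions = fun ε => minimizers (M.discSlackFeasible ε) (cost γ) := by
  ext1 ε
  rw [PerturbedLP.solutions, perturbedLP_feasible, perturbedLP_objective, maximizers_neg]

theorem perturbedLP_value :
    (M.perturbedLP γ).value = fun ε => -minValue (M.discSlackFeasible ε) (cost γ) := by
  ext1 ε
  rw [PerturbedLP.value, perturbedLP_feasible, perturbedLP_objective, maxValue_neg]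

theorem perturbedLP_maximizers_theta₁ :
    maximizers (M.perturbedLP γ).theta₁ ((M.perturbedLP γ).objective 0)
      = Prod.fst '' minimizers M.avgSlackFeasible (fun y => cost γ y.1) := by
  rw [image_minimizers_comp, perturbedLP_theta₁, perturbedLP_objective, maximizers_neg]

theorem perturbedLP_maxValue_theta₁ :
    maxValue (M.perturbedLP γ).theta₁ ((M.perturbedLP γ).objective 0)
      = -minValue M.avgSlackFeasible (fun y => cost γ y.1) := by
  rw [perturbedLP_theta₁, perturbedLP_objective, maxValue_neg, minValue_image]

theorem perturbedLP_H1 : (M.perturbedLP γ).H1 := by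
  have hrange : LinearMap.range (M.perturbedLP γ).A₀.mulVecLin = ⊤ :=
    LinearMap.range_eq_top.2 fun b => ⟨Sum.elim 0 (-b), funext fun s => by
      simp [perturbedLP_A₀_mulVec]⟩
  rw [PerturbedLP.H1, Matrix.rank, hrange, finrank_top, Module.finrank_fintype_fun_eq_card]

theorem inl_mem_perturbedLP_J₀ (j : S) : Sum.inl j ∈ (M.perturbedLP γ).J₀ :=
  ⟨_, M.perturbedLP_feasible γ 0 ▸ M.const_mem_discSlackFeasible zero_le_one (by simp), one_pos⟩

-- Let `z ∈ θ(0)` be positive on `J₀`, which contains all the states. For large `C` the point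
-- `x⁰ = C z` has `v⁰_i > r_ia`, and then `v¹ = 0` leaves the positive slack `v⁰_i - r_ia`.
theorem perturbedLP_ES1 : (M.perturbedLP γ).ES1 := by
  obtain ⟨z, hz, hzpos⟩ := PerturbedLP.exists_feasible_zero_pos (P := M.perturbedLP γ) rfl
  have hlarge : ∀ᶠ C : ℝ in atTop,
      (fun s : Σ i, A i => M.r s.1 s.2 + 1) ≤ 0 + C • fun s => z (.inl s.1) :=
    eventually_le_add_smul (fun s => hz.2 _)
      fun s hs => ((hzpos _ (M.inl_mem_perturbedLP_J₀ γ s.1)).ne' hs).elim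
  obtain ⟨C, hCr, hC⟩ := (hlarge.and (eventually_gt_atTop 0)).exists
  have hslack : ∀ s : Σ i, A i, 0 < C * z (.inl s.1) - M.r s.1 s.2 := fun s => by
    have hle : M.r s.1 s.2 + 1 ≤ 0 + C * z (.inl s.1) := hCr s
    linarith
  have hpos : ∀ t ∉ (M.perturbedLP γ).J₀,
      0 < Sum.elim (0 : S → ℝ) (fun s : Σ i, A i => C * z (.inl s.1) - M.r s.1 s.2) t := by
    rintro (j | s) ht
    · exact (ht (M.inl_mem_perturbedLP_J₀ γ j)).elim
    · exact hslack s
  refine ⟨(C • z, Sum.elim 0 fun s => C * z (.inl s.1) - M.r s.1 s.2), ⟨?_, ?_,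
    fun t ht => (hpos t ht).le⟩, hpos, fun t ht => mul_pos hC (hzpos t ht)⟩
  · have hz₀ : (M.perturbedLP γ).A₀.mulVec z = 0 := (PerturbedLP.mem_feasible_zero.1 hz).1
    refine PerturbedLP.mem_feasible_zero.2 ⟨?_, smul_nonneg hC.le hz.2⟩
    rw [Matrix.mulVec_smul, hz₀, smul_zero]
    rfl
  · ext s
    simp only [Pi.add_apply, perturbedLP_A₀_mulVec, perturbedLP_A₁_mulVec]
    simp [perturbedLP]

variable {γ}

theorem perturbedLP_solutions_nonempty (hγ : ∀ j, 0 < γ j) {ε : ℝ} (hε : 0 ≤ ε) :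
    ((M.perturbedLP γ).solutions ε).Nonempty := by
  obtain ⟨c, hc⟩ := M.exists_discSlackFeasible_cost_le γ
  obtain ⟨x₀, hx₀, hx₀c⟩ := hc ε hε
  obtain ⟨u, hu⟩ := M.exists_mem_Icc_of_cost_le hγ ε c
  have hclosed : IsClosed (M.discSlackFeasible ε) :=
    M.perturbedLP_feasible γ ε ▸ (M.perturbedLP γ).isClosed_feasible ε
  have hcoercive : ∀ᶠ x in cocompact _ ⊓ 𝓟 (M.discSlackFeasible ε), cost γ x₀ ≤ cost γ x := by
    rw [eventually_inf_principal]
    filter_upwards [(isCompact_Icc (a := 0) (b := u)).compl_mem_cocompact] with x hxu hx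
    by_contra! hlt
    exact hxu (hu ε ⟨hε, le_rfl⟩ x hx (hlt.le.trans hx₀c))
  obtain ⟨x, hx, hmin⟩ :=
    (continuous_cost γ).continuousOn.exists_isMinOn' hclosed hx₀ hcoercive
  rw [perturbedLP_solutions]
  exact ⟨x, hx, fun y hy => hmin hy⟩

theorem perturbedLP_H0star (hγ : ∀ j, 0 < γ j) : (M.perturbedLP γ).H0star := by
  obtain ⟨c, hc⟩ := M.exists_discSlackFeasible_cost_le γ
  obtain ⟨u, hu⟩ := M.exists_mem_Icc_of_cost_le hγ 1 c
  refine ⟨1, one_pos, Set.Icc 0 u, Metric.isBounded_Icc 0 u, fun ε hε hε₁ x hx => ?_⟩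
  rw [perturbedLP_solutions] at hx
  obtain ⟨x₀, hx₀, hx₀c⟩ := hc ε hε.le
  exact hu ε ⟨hε.le, hε₁⟩ x hx.1 ((hx.2 x₀ hx₀).trans hx₀c)

end PerturbedLP

end MDP

theorem mainTheorem4 {S : Type*} [Fintype S] [DecidableEq S] {A : S → Type*}
    [∀ i, Fintype (A i)] [∀ i, DecidableEq (A i)] (M : MDP S A)
    (γ : S → ℝ) (hγ : ∀ j, 0 < γ j) :
    -- with `ε = (1 - α) / α`, the discounted program becomes the program with slack variables
    (∀ α : ℝ, 0 < α → α < 1 → ∀ ε : ℝ, ε = (1 - α) / α →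
      Set.BijOn (M.rescale ε) (M.discFeasible α) (M.discSlackFeasible ε) ∧
      ∀ w : S → ℝ, MDP.cost γ (M.rescale ε w) = ε / (1 + ε) * ∑ j, γ j * w j) ∧
    -- the latter is a perturbed linear program
    (∀ ε : ℝ, (M.perturbedLP γ).feasible ε = M.discSlackFeasible ε ∧
      ∀ x, (M.perturbedLP γ).objective ε x = -MDP.cost γ x) ∧
    -- the program of the long-run average process is the associated limiting program
    (M.perturbedLP γ).ThetaTilde₁ = M.avgSlackFeasible ∧
    (M.perturbedLP γ).theta₁ = Prod.fst '' M.avgSlackFeasible ∧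
    -- the assumptions hold
    (M.perturbedLP γ).H0star ∧ (M.perturbedLP γ).H1 ∧ (M.perturbedLP γ).ES1 ∧
    -- both problems have optimal solutions
    (∀ ε : ℝ, 0 < ε → (minimizers (M.discSlackFeasible ε) (MDP.cost γ)).Nonempty) ∧
    (minimizers M.avgSlackFeasible (fun y => MDP.cost γ y.1)).Nonempty ∧
    -- convergence of the optimal solutions and of the optimal values
    outerLimit (fun ε => minimizers (M.discSlackFeasible ε) (MDP.cost γ)) ⊆
      Prod.fst '' minimizers M.avgSlackFeasible (fun y => MDP.cost γ y.1) ∧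
    Filter.Tendsto (fun ε => minValue (M.discSlackFeasible ε) (MDP.cost γ))
      (nhdsWithin (0 : ℝ) (Set.Ioi 0))
      (nhds (minValue M.avgSlackFeasible (fun y => MDP.cost γ y.1))) ∧
    -- optimal solutions of the limiting program are feasible limiting optimal
    (∀ x ∈ Prod.fst '' minimizers M.avgSlackFeasible (fun y => MDP.cost γ y.1),
      (M.perturbedLP γ).FeasibleLimitingOptimal x) := by
  have h₀ : (M.perturbedLP γ).H0star := M.perturbedLP_H0star hγ
  have h₁ : (M.perturbedLP γ).H1 := M.perturbedLP_H1 γ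
  have hES : (M.perturbedLP γ).ES1 := M.perturbedLP_ES1 γ
  have hsol : ∀ ε : ℝ, 0 < ε → ((M.perturbedLP γ).solutions ε).Nonempty :=
    fun ε hε => M.perturbedLP_solutions_nonempty hγ hε.le
  have hsol_ev : ∀ᶠ ε in 𝓝[>] 0, ((M.perturbedLP γ).solutions ε).Nonempty :=
    eventually_mem_nhdsWithin.mono hsol
  rw [← M.perturbedLP_maximizers_theta₁ γ, ← M.perturbedLP_solutions γ]
  refine ⟨fun α hα hα₁ ε hε => ⟨?_, M.cost_rescale γ ε⟩,
    fun ε => ⟨M.perturbedLP_feasible γ ε, congrFun (M.perturbedLP_objective γ ε)⟩,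
    M.perturbedLP_ThetaTilde₁ γ, M.perturbedLP_theta₁ γ, h₀, h₁, hES,
    fun ε hε => congrFun (M.perturbedLP_solutions γ) ε ▸ hsol ε hε, ?_,
    PerturbedLP.outerLimit_solutions_subset h₁ hES, ?_,
    fun _ => PerturbedLP.feasibleLimitingOptimal_of_mem_maximizers_theta₁ h₀ h₁ hES hsol_ev⟩
  · obtain rfl : α = (1 + ε)⁻¹ := by rw [hε]; field_simp; ring
    exact M.bijOn_rescale (hε ▸ div_pos (sub_pos.2 hα₁) hα)
  · have hne := PerturbedLP.maximizers_theta₁_nonempty h₀ h₁ hES hsol_ev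
    rw [M.perturbedLP_maximizers_theta₁ γ] at hne
    exact hne.of_image
  · have hlim := PerturbedLP.tendsto_value h₀ h₁ hES hsol_ev
    rw [M.perturbedLP_value γ, M.perturbedLP_maxValue_theta₁ γ] at hlim
    simpa only [neg_neg] using hlim.neg
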